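/- Let $V$ be a finite set of attributes, each with a finite domain, let $\Pr$ be a joint probability distribution of the attributes, and let $G$ be a directed acyclic graph with node set $V$ that satisfies the Markov condition: every node is independent of its non-descendants conditionally on its parents. Let $C\in V$ (the protected attribute) have the two values $c^+,c^-$ and let $E\in V$ (the decision) have the two values $e^+,e^-$, and assume that $C\to E$ is an arc of $G$. Let $\tau>0$. For a value assignment $s$ to a set $S\subseteq V$, put $$\Delta P|_{s}=\Pr(e^+\mid c^+,s)-\Pr(e^+\mid c^-,s),$$ which is defined when $\Pr(c^+,s)>0$ and $\Pr(c^-,s)>0$. Let $G'$ be $G$ with the arc $C\to E$ deleted. A block set is a set $B\subseteq V\setminus\{C,E\}$ such that $C$ and $E$ are d-separated by $B$ in $G'$ and $B$ contains no descendant of $E$. (Nodes $x,y$ are d-separated by $Z$ if every undirected path without repeated nodes from $x$ to $y$ contains a chain $i\to m\to j$ or a fork $i\leftarrow m\to j$ with $m\in Z$, or a collider $i\to m\leftarrow j$ such that neither $m$ nor any descendant of $m$ is in $Z$; chains may be traversed in either direction.) Non-discrimination is said to hold if $|\Delta P|_{b}|<\tau$ for every block set $B$ and every value assignment $b$ of $B$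 for which $\Delta P|_{b}$ is defined. Let $Q=\mathrm{Par}(E)\setminus\{C\}$, the set of all parents of $E$ other than $C$. Then: 1. Non-discrimination holds if and only if $|\Delta P|_{q}|<\tau$ for every value assignment $q$ of $Q$ for which $\Delta P|_{q}$ is defined. 2. $Q$ is a block set. 3. For every block set $B$ and every value assignment $b$ of $B$ for which $\Delta P|_{b}$ is defined, $$\Delta P|_{b}=\sum_{q'}\Pr(q'\mid b)\,\Delta P|_{q},$$ where $q'$ runs over the value assignments of $Q\setminus B$, and $q$ is the assignment of $Q$ that agrees with $q'$ on $Q\setminus B$ and with $b$ on $Q\cap B$. Here $\Delta P|_{q}$ is defined for every $q'$ with $\Pr(q'\mid b)>0$ (terms with $\Pr(q'\mid b)=0$ count as $0$), and the weights $\Pr(q'\mid b)$ sum to $1$. -/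

import Mathlib

/-- A directed acyclic graph on the node set `V`; `arc u v` means `u → v`. -/
structure CausalDAG (V : Type*) where
  arc : V → V → Prop
  acyclic : ∀ v, ¬ Relation.TransGen arc v v

namespace CausalDAG

/-- `v` is a (proper) descendant of `u`: there is a directed path of length at least one
from `u` to `v`. -/
def IsDescendant {V : Type*} (G : CausalDAG V) (u v : V) : Prop :=
  Relation.TransGen G.arc u v

/-- The graph obtained from `G` by deleting the arc `a → b` and keeping everything else. -/
def deleteArc {V : Type*} (G : CausalDAG V) (a b : V) : CausalDAG V where
  arc u v := G.arc u v ∧ ¬ (u = a ∧ v = b)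
  acyclic v h := G.acyclic v (Relation.TransGen.mono (fun _ _ h' => h'.1) _ _ h)

/-- The underlying undirected graph of `G`. -/
def skeleton {V : Type*} (G : CausalDAG V) : SimpleGraph V :=
  SimpleGraph.fromRel G.arc

/-- `i, m, j` form, in this order or reversed, a chain `i → m → j`, or a fork `i ← m → j`. -/
def IsChainOrFork {V : Type*} (G : CausalDAG V) (i m j : V) : Prop :=
  (G.arc i m ∧ G.arc m j) ∨ (G.arc j m ∧ G.arc m i) ∨ (G.arc m i ∧ G.arc m j)

/-- `i, m, j` form a collider `i → m ← j`. -/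
def IsCollider {V : Type*} (G : CausalDAG V) (i m j : V) : Prop :=
  G.arc i m ∧ G.arc j m

/-- The walk `w` is blocked by `Z`: it has three consecutive nodes `i, m, j` that either form a
chain or a fork with `m ∈ Z`, or form a collider such that neither `m` nor any descendant of `m`
is in `Z`. -/
def Blocks {V : Type*} (G : CausalDAG V) (Z : Finset V) {x y : V}
    (w : G.skeleton.Walk x y) : Prop :=
  ∃ k : ℕ, k + 2 ≤ w.length ∧
    ((G.IsChainOrFork (w.getVert k) (w.getVert (k + 1)) (w.getVert (k + 2)) ∧
        w.getVert (k + 1) ∈ Z) ∨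
      (G.IsCollider (w.getVert k) (w.getVert (k + 1)) (w.getVert (k + 2)) ∧
        w.getVert (k + 1) ∉ Z ∧ ∀ d, G.IsDescendant (w.getVert (k + 1)) d → d ∉ Z))

/-- d-separation of the nodes `x` and `y` by `Z`: every path (without repeated nodes, arcs
traversed in either direction) from `x` to `y` is blocked by `Z`. -/
def DSeparated {V : Type*} (G : CausalDAG V) (x y : V) (Z : Finset V) : Prop :=
  ∀ w : G.skeleton.Walk x y, w.IsPath → G.Blocks Z w

/-- `B` is a block set for the protected attribute `C` and the decision `E`: a set of attributes
other than `C` and `E` which d-separates `C` and `E` in the graph without the arc `C → E`, and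
which contains no descendant of `E`. -/
def IsBlockSet {V : Type*} (G : CausalDAG V) (C E : V) (B : Finset V) : Prop :=
  C ∉ B ∧ E ∉ B ∧ (G.deleteArc C E).DSeparated C E B ∧ ∀ d, G.IsDescendant E d → d ∉ B

open Classical in
/-- The set `Par(x)` of parents of `x`. -/
noncomputable def parents {V : Type*} [Fintype V] (G : CausalDAG V) (x : V) : Finset V :=
  {v | G.arc v x}

open Classical in
/-- The nodes other than `x` that are not descendants of `x`. -/
noncomputable def nonDescendants {V : Type*} [Fintype V] (G : CausalDAG V) (x : V) : Finset V :=
  {v | v ≠ x ∧ ¬ G.IsDescendant x v}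

/-- The value assignments to a set `S` of attributes, attribute `v` having domain `α v`. -/
abbrev Assign {V : Type*} (α : V → Type*) (S : Finset V) : Type _ :=
  (v : S) → α v

/-- The event that the attributes in `S` take the values `s`. -/
def event {V : Type*} {α : V → Type*} {S : Finset V} (s : Assign α S) : Set (∀ v, α v) :=
  {x | ∀ v : S, x v = s v}

/-- The event that the attribute `v` takes the value `a`. -/
def eventEq {V : Type*} {α : V → Type*} (v : V) (a : α v) : Set (∀ v, α v) :=
  {x | x v = a}

/-- `Pr(A)`, as a real number. -/
noncomputable def prob {Ω : Type*} [Fintype Ω] (P : PMF Ω) (A : Set Ω) : ℝ :=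
  ∑ x, A.indicator (fun x => (P x).toReal) x

/-- `Pr(A | B)`; only meaningful when `Pr(B) > 0`. -/
noncomputable def condProb {Ω : Type*} [Fintype Ω] (P : PMF Ω) (A B : Set Ω) : ℝ :=
  prob P (A ∩ B) / prob P B

/-- Conditional independence of the attribute sets `S` and `T` given `Z`:
`Pr(s | t, z) = Pr(s | z)` for all values `s, t, z` with `Pr(t, z) > 0`. -/
def CondIndep {V : Type*} [Fintype V] [DecidableEq V] {α : V → Type*} [∀ v, Fintype (α v)]
    (P : PMF (∀ v, α v)) (S T Z : Finset V) : Prop :=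
  ∀ (s : Assign α S) (t : Assign α T) (z : Assign α Z), 0 < prob P (event t ∩ event z) →
    condProb P (event s) (event t ∩ event z) = condProb P (event s) (event z)

/-- The Markov condition: each node is independent of its non-descendants conditionally on its
parents. -/
def Markov {V : Type*} [Fintype V] [DecidableEq V] {α : V → Type*} [∀ v, Fintype (α v)]
    (G : CausalDAG V) (P : PMF (∀ v, α v)) : Prop :=
  ∀ x : V, CondIndep P {x} (G.nonDescendants x) (G.parents x)

/-- The risk difference `ΔP|_s = Pr(e⁺ | c⁺, s) - Pr(e⁺ | c⁻, s)`. -/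
noncomputable def riskDiff {V : Type*} [Fintype V] [DecidableEq V] {α : V → Type*}
    [∀ v, Fintype (α v)] (P : PMF (∀ v, α v)) {C E : V} (cpos cneg : α C) (epos : α E)
    {S : Finset V} (s : Assign α S) : ℝ :=
  condProb P (eventEq E epos) (eventEq C cpos ∩ event s) -
    condProb P (eventEq E epos) (eventEq C cneg ∩ event s)

/-- `ΔP|_s` is defined: both conditioning events `(c⁺, s)` and `(c⁻, s)` have positive
probability. -/
def RiskDiffDefined {V : Type*} [Fintype V] [DecidableEq V] {α : V → Type*}
    [∀ v, Fintype (α v)] (P : PMF (∀ v, α v)) {C : V} (cpos cneg : α C)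
    {S : Finset V} (s : Assign α S) : Prop :=
  0 < prob P (eventEq C cpos ∩ event s) ∧ 0 < prob P (eventEq C cneg ∩ event s)

/-- Non-discrimination: `|ΔP|_b| < τ` for each value assignment `b` (for which `ΔP|_b` is defined)
of each block set `B`. -/
def NonDiscrimination {V : Type*} [Fintype V] [DecidableEq V] {α : V → Type*}
    [∀ v, Fintype (α v)] (G : CausalDAG V) (P : PMF (∀ v, α v)) {C E : V}
    (cpos cneg : α C) (epos : α E) (τ : ℝ) : Prop :=
  ∀ B : Finset V, G.IsBlockSet C E B → ∀ b : Assign α B, RiskDiffDefined P cpos cneg b →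
    |riskDiff P cpos cneg epos b| < τ

/-- The assignment to `Q` that agrees with `b` on `Q ∩ B` and with `q'` on `Q \ B`. -/
def glue {V : Type*} [DecidableEq V] {α : V → Type*} {B Q : Finset V}
    (b : Assign α B) (q' : Assign α (Q \ B)) : Assign α Q :=
  fun v => if h : v.1 ∈ B then b ⟨v.1, h⟩ else q' ⟨v.1, Finset.mem_sdiff.2 ⟨v.2, h⟩⟩

end CausalDAG

namespace CausalDAG

/-! ### Active walks and d-separation. -/

section Graph

open Relation

variable {V : Type*} {G : CausalDAG V} {Z : Finset V} {x y : V}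

/-! For a block set B, two independences carry the proof. Given B, the attribute C is independent of
Q \ B (`IsBlockSet.prob_mul_prob`). Given Par(E), the decision E is independent of B, because C, Q
and B consist of non-descendants of E (`IsBlockSet.prob_mul_prob_glue`). Together they give Pr(e |
c, b) = ∑ Pr(q' | b) Pr(e | c, q) with weights that do not depend on c, so ΔP|_b is a weighted
average of the ΔP|_q. Averages of numbers below τ in absolute value stay below τ, and Q is itself a
block set; this yields the equivalence.

The first independence is the hard one, since P is Markov for G while the separation is in G'.
Absence of blocked-free paths in G' is turned into a cut of a moral graph
(`DSeparated.exists_separating`): a set L containing C but not E such that no family (a relevant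
node with its parents) meets both L and the complement of L ∪ B. Dropping E from the relevant nodes
leaves a set S that is ancestral in G and whose families are the same in G and G'. The marginal on S
factorizes over families, so exchanging the L-coordinates of two assignments that agree on B
preserves the product of their probabilities; this symmetry is the independence. -/

theorem arc_asymm {u v : V} (h : G.arc u v) : ¬ G.arc v u := fun h' =>
  G.acyclic u (.head h (.single h'))

theorem skeleton_adj {u v : V} : G.skeleton.Adj u v ↔ G.arc u v ∨ G.arc v u := by
  refine ⟨fun h => h.2, fun h => ⟨?_, h⟩⟩
  rintro rfl
  exact G.acyclic u (.single (h.elim id id))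

/-- The consecutive nodes `i, m, j` do not block a path, given `Z`. -/
def IsActiveAt (G : CausalDAG V) (Z : Finset V) (i m j : V) : Prop :=
  (G.IsCollider i m j → ∃ d ∈ Z, ReflTransGen G.arc m d) ∧ (G.arc m i ∨ G.arc m j → m ∉ Z)

/-- `p 0, …, p n` are successively adjacent and form an active sequence of nodes given `Z`. -/
structure IsActiveSeq (G : CausalDAG V) (Z : Finset V) (p : ℕ → V) (n : ℕ) : Prop where
  adj : ∀ k, k < n → G.skeleton.Adj (p k) (p (k + 1))
  active : ∀ k, k + 2 ≤ n → G.IsActiveAt Z (p k) (p (k + 1)) (p (k + 2))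

theorem exists_walk_getVert (H : SimpleGraph V) (n : ℕ) (p : ℕ → V)
    (h : ∀ k, k < n → H.Adj (p k) (p (k + 1))) :
    ∃ w : H.Walk (p 0) (p n), w.length = n ∧ ∀ k ≤ n, w.getVert k = p k := by
  induction n generalizing p with
  | zero => exact ⟨.nil, rfl, fun k hk => by simp [Nat.le_zero.1 hk]⟩
  | succ n ih =>
    obtain ⟨w, hw, hp⟩ := ih (fun k => p (k + 1)) fun k hk => h (k + 1) (by omega)
    refine ⟨.cons (h 0 (by omega)) w, by simp [hw], fun k hk => ?_⟩
    cases k with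
    | zero => simp
    | succ k => simpa using hp k (by omega)

/-- A directed stretch of an active sequence which is finally met by an opposite arc leads
to `Z`. -/
theorem IsActiveSeq.exists_reflTransGen {p : ℕ → V} {n : ℕ} (hp : G.IsActiveSeq Z p n)
    (l t : ℕ) (hn : t + l + 2 ≤ n) (ht : G.arc (p t) (p (t + 1)))
    (hj : G.arc (p (t + l + 2)) (p (t + l + 1))) :
    ∃ d ∈ Z, ReflTransGen G.arc (p t) d := by
  induction l generalizing t with
  | zero =>
    obtain ⟨d, hd, h⟩ := (hp.active t hn).1 ⟨ht, hj⟩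
    exact ⟨d, hd, .head ht h⟩
  | succ l ih =>
    rcases skeleton_adj.1 (hp.adj (t + 1) (by omega)) with h | h
    · obtain ⟨d, hd, h⟩ := ih (t + 1) (by omega) h
        (by rwa [show t + 1 + l + 2 = t + (l + 1) + 2 by omega,
          show t + 1 + l + 1 = t + (l + 1) + 1 by omega])
      exact ⟨d, hd, .head ht h⟩
    · obtain ⟨d, hd, h⟩ := (hp.active t (by omega)).1 ⟨ht, h⟩
      exact ⟨d, hd, .head ht h⟩

/-- Cutting out the loop between two visits of a node preserves activity. -/
theorem IsActiveSeq.cut {p : ℕ → V} {i l n : ℕ} (hp : G.IsActiveSeq Z p (n + (l + 1)))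
    (hi : i ≤ n) (h : p i = p (i + (l + 1))) :
    G.IsActiveSeq Z (fun k => if k ≤ i then p k else p (k + (l + 1))) n := by
  have shift : ∀ k, i ≤ k → (if k ≤ i then p k else p (k + (l + 1))) = p (k + (l + 1)) := by
    intro k hk
    split_ifs with hk'
    · rw [le_antisymm hk' hk, h]
    · rfl
  have keep : ∀ k, k ≤ i → (if k ≤ i then p k else p (k + (l + 1))) = p k := fun k hk =>
    if_pos hk
  constructor
  · intro k hk
    rcases lt_or_ge k i with hki | hki
    · rw [keep k hki.le, keep (k + 1) hki]
      exact hp.adj k (by omega)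
    · rw [shift k hki, shift (k + 1) (by omega), add_right_comm]
      exact hp.adj _ (by omega)
  · intro k hk
    rcases lt_trichotomy (k + 1) i with hki | hki | hki
    · rw [keep k (by omega), keep (k + 1) (by omega), keep (k + 2) (by omega)]
      exact hp.active k (by omega)
    · subst hki
      rw [keep k (by omega), keep (k + 1) le_rfl, shift (k + 2) (by omega)]
      have h₁ := hp.active k (by omega)
      have h₂ := hp.active (k + (l + 1)) (by omega)
      rw [add_right_comm k 1] at h
      rw [add_right_comm k (l + 1) 2, ← h] at h₂
      refine ⟨fun hc => ?_, ?_⟩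
      -- The cut makes the junction a collider. If the loop leaves the junction along an outgoing
      -- arc, it must turn before it comes back or on the way out, and that turn is a collider below
      -- the junction; otherwise the junction was already a collider on its first visit.
      · rcases skeleton_adj.1 (hp.adj (k + 1) (by omega)) with h' | h'
        · refine hp.exists_reflTransGen l (k + 1) (by omega) h' ?_
          rw [show k + 1 + l + 1 = k + (l + 1) + 1 by omega, ← h,
            show k + 1 + l + 2 = k + 2 + (l + 1) by omega]
          exact hc.2
        · exact h₁.1 ⟨hc.1, h'⟩
      · rintro (h' | h')
        · exact h₁.2 (.inl h')
        · exact h₂.2 (.inr h')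
    · rw [shift k (by omega), shift (k + 1) (by omega), shift (k + 2) (by omega),
        add_right_comm k 1, add_right_comm k 2]
      exact hp.active _ (by omega)

/-- Cutting loops shortens an active walk until it is a path, so d-separation, defined by paths,
also excludes active walks with repeated nodes. -/
theorem DSeparated.not_isActiveSeq (h : G.DSeparated x y Z) (n : ℕ) (p : ℕ → V)
    (h0 : p 0 = x) (hn : p n = y) : ¬ G.IsActiveSeq Z p n := by
  induction n using Nat.strong_induction_on generalizing p with
  | _ n ih =>
    intro hp
    by_cases hinj : ∀ i j, i < j → j ≤ n → p i ≠ p j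
    · obtain ⟨w, hw, hv⟩ := exists_walk_getVert G.skeleton n p hp.adj
      subst h0 hn
      have hpath : w.IsPath := by
        rw [← SimpleGraph.Walk.IsPath.getVert_injOn_iff]
        intro i hi j hj hij
        simp only [Set.mem_ofPred_eq, hw] at hi hj
        rw [hv i hi, hv j hj] at hij
        rcases lt_trichotomy i j with hlt | heq | hlt
        · exact absurd hij (hinj i j hlt hj)
        · exact heq
        · exact absurd hij.symm (hinj j i hlt hi)
      obtain ⟨k, hk, hb⟩ := h w hpath
      rw [hw] at hk
      rw [hv k (by omega), hv (k + 1) (by omega), hv (k + 2) hk] at hb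
      obtain ⟨h₁, h₂⟩ := hp.active k hk
      rcases hb with ⟨hcf, hm⟩ | ⟨hc, hm, hd⟩
      · refine h₂ ?_ hm
        rcases hcf with h' | h' | h'
        exacts [.inr h'.2, .inl h'.2, .inl h'.1]
      · obtain ⟨d, hdZ, hmd⟩ := h₁ hc
        rcases reflTransGen_iff_eq_or_transGen.1 hmd with rfl | hmd
        exacts [hm hdZ, hd d hmd hdZ]
    · push Not at hinj
      obtain ⟨i, j, hij, hj, he⟩ := hinj
      obtain ⟨l, rfl⟩ := Nat.exists_eq_add_of_lt hij
      obtain ⟨m, rfl⟩ := Nat.exists_eq_add_of_le hj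
      rw [show i + l + 1 + m = i + m + (l + 1) by omega] at *
      refine ih (i + m) (by omega) _ (by simpa using h0) ?_ (hp.cut (by omega) he)
      split_ifs with hm
      · obtain rfl : m = 0 := by omega
        exact he.trans hn
      · exact hn

/-- There is an active sequence of nodes given `Z` that starts in `x` and ends with `i, m`. -/
inductive ActiveTrail (G : CausalDAG V) (Z : Finset V) (x : V) : V → V → Prop
  | first {u : V} : G.skeleton.Adj x u → ActiveTrail G Z x x u
  | step {i m j : V} : ActiveTrail G Z x i m → G.skeleton.Adj m j → G.IsActiveAt Z i m j →
      ActiveTrail G Z x m j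

theorem ActiveTrail.exists_seq {i m : V} (h : G.ActiveTrail Z x i m) :
    ∃ (n : ℕ) (p : ℕ → V), G.IsActiveSeq Z p (n + 1) ∧ p 0 = x ∧ p n = i ∧ p (n + 1) = m := by
  induction h with
  | @first u h =>
    refine ⟨0, fun k => if k = 0 then x else u, ⟨?_, fun k hk => by omega⟩, by simp⟩
    intro k hk
    obtain rfl : k = 0 := by omega
    simpa using h
  | @step i m j _ hadj hact ih =>
    obtain ⟨n, p, hp, h0, hi, hm⟩ := ih
    have keep : ∀ k, k ≤ n + 1 → (if k ≤ n + 1 then p k else j) = p k := fun k hk => if_pos hk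
    refine ⟨n + 1, fun k => if k ≤ n + 1 then p k else j, ⟨?_, ?_⟩, by simpa, by simpa, by simp⟩
    · intro k hk
      rcases Nat.lt_succ_iff_lt_or_eq.1 hk with hk | rfl
      · rw [keep k (by omega), keep (k + 1) (by omega)]
        exact hp.adj k hk
      · rw [keep _ le_rfl, if_neg (by omega), hm]
        exact hadj
    · intro k hk
      rcases Nat.le_or_eq_of_le_succ hk with hk | hk
      · rw [keep k (by omega), keep (k + 1) (by omega), keep (k + 2) (by omega)]
        exact hp.active k hk
      · obtain rfl : k = n := by omega
        rw [keep k (by omega), keep (k + 1) (by omega), if_neg (by omega), hi, hm]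
        exact hact

/-- There is an active sequence of nodes given `Z` from `x` to `u`. -/
def ActiveReach (G : CausalDAG V) (Z : Finset V) (x u : V) : Prop :=
  u = x ∨ ∃ i, G.ActiveTrail Z x i u

/-- A node left along an outgoing arc is not a collider, so lying outside `Z` is enough. -/
theorem ActiveReach.trail_of_arc {u v : V} (h : G.ActiveReach Z x u) (huv : G.arc u v)
    (hu : u ∉ Z) : G.ActiveTrail Z x u v := by
  rcases h with rfl | ⟨i, hi⟩
  · exact .first (skeleton_adj.2 (.inl huv))
  · exact .step hi (skeleton_adj.2 (.inl huv)) ⟨fun hc => absurd hc.2 (arc_asymm huv), fun _ => hu⟩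

theorem ActiveTrail.trail_of_arc_to {i u v : V} (h : G.ActiveTrail Z x i u) (hvu : G.arc v u)
    (hu : G.arc u i → u ∉ Z) (hd : ∃ d ∈ Z, ReflTransGen G.arc u d) :
    G.ActiveTrail Z x u v :=
  .step h (skeleton_adj.2 (.inr hvu))
    ⟨fun _ => hd, fun h' => h'.elim hu fun h' => absurd h' (arc_asymm hvu)⟩

theorem ActiveReach.descend {u v : V} (h : G.ActiveReach Z x u) (huv : ReflTransGen G.arc u v)
    (hu : ∀ d ∈ Z, ¬ ReflTransGen G.arc u d) : G.ActiveReach Z x v := by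
  induction huv with
  | refl => exact h
  | tail hm hmv ih => exact .inr ⟨_, ih.trail_of_arc hmv fun hmZ => hu _ hmZ hm⟩

/-- Climb from `x` against a directed path from `c`: every node passed is a non-collider and
descends from `c`, hence is outside `Z`. -/
theorem exists_trail_of_ancestor {c v : V} (hc : ReflTransGen G.arc c x)
    (hd : ∀ d ∈ Z, ¬ ReflTransGen G.arc c d) (hv : G.arc v c) : G.ActiveTrail Z x c v := by
  induction hc using ReflTransGen.head_induction_on generalizing v with
  | refl => exact .first (skeleton_adj.2 (.inr hv))
  | @head a b hab _ ih =>
    refine .step (ih (fun d hdZ h => hd d hdZ (.head hab h)) hab) (skeleton_adj.2 (.inr hv))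
      ⟨fun hcol => absurd hcol.1 (arc_asymm hab), fun _ haZ => hd a haZ .refl⟩

/-! ### From d-separation to separation in the moral graph. -/

/-- `c` lies in the smallest ancestral set containing `x`, `y` and `Z`. -/
def IsRelevant (G : CausalDAG V) (x y : V) (Z : Finset V) (c : V) : Prop :=
  ReflTransGen G.arc c x ∨ ReflTransGen G.arc c y ∨ ∃ d ∈ Z, ReflTransGen G.arc c d

/-- Adjacency (or equality) in the moral graph of the smallest ancestral set containing `x`, `y`
and `Z`, with the nodes of `Z` removed. -/
def MoralAdj (G : CausalDAG V) (x y : V) (Z : Finset V) (u v : V) : Prop :=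
  u ∉ Z ∧ v ∉ Z ∧ ∃ c, G.IsRelevant x y Z c ∧ (u = c ∨ G.arc u c) ∧ (v = c ∨ G.arc v c)

/-- A moral edge is followed through its common family node `c`. A collider at `c` is open if `c`
leads to `Z`. If not, and `c` is an ancestor of `x`, the walk so far is replaced by a climb from `x`
to `c`; if `c` is an ancestor of `y`, one descends to `y` at once, which is the second alternative.
-/
theorem activeReach_of_moral {u : V} (h : ReflTransGen (G.MoralAdj x y Z) x u) :
    G.ActiveReach Z x u ∨ G.ActiveReach Z x y := by
  induction h with
  | refl => exact .inl (.inl rfl)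
  | @tail u v _ huv ih =>
    obtain ⟨hu, hv, c, hc, huc, hvc⟩ := huv
    rcases ih with ih | ih
    swap
    · exact .inr ih
    have hreach : G.ActiveReach Z x c := by
      rcases huc with rfl | huc
      exacts [ih, .inr ⟨_, ih.trail_of_arc huc hu⟩]
    rcases hvc with rfl | hvc
    · exact .inl hreach
    by_cases hd : ∃ d ∈ Z, ReflTransGen G.arc c d
    · rcases huc with rfl | huc
      · rcases ih with rfl | ⟨i, hi⟩
        · exact .inl (.inr ⟨_, .first (skeleton_adj.2 (.inr hvc))⟩)
        · exact .inl (.inr ⟨_, hi.trail_of_arc_to hvc (fun _ => hu) hd⟩)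
      · exact .inl (.inr ⟨_, (ih.trail_of_arc huc hu).trail_of_arc_to hvc
          (fun h' => absurd h' (arc_asymm huc)) hd⟩)
    · have hd' : ∀ d ∈ Z, ¬ ReflTransGen G.arc c d := fun d hdZ h' => hd ⟨d, hdZ, h'⟩
      rcases hc with hc | hc | hc
      · exact .inl (.inr ⟨_, exists_trail_of_ancestor hc hd' hvc⟩)
      · exact .inr (hreach.descend hc hd')
      · exact absurd hc hd

/-- `L` is the component of `x` in the moral graph with `Z` removed; reaching `y` there would give
an active walk. -/
theorem DSeparated.exists_separating (h : G.DSeparated x y Z) (hxy : x ≠ y) (hx : x ∉ Z) :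
    ∃ L : Set V, x ∈ L ∧ y ∉ L ∧ (∀ u ∈ L, u ∉ Z) ∧
      ∀ c, G.IsRelevant x y Z c → ∀ u v, (u = c ∨ G.arc u c) → (v = c ∨ G.arc v c) →
        u ∈ L → v ∉ Z → v ∈ L := by
  have hL : ∀ u, ReflTransGen (G.MoralAdj x y Z) x u → u ∉ Z := by
    intro u hu
    cases hu with
    | refl => exact hx
    | tail _ h' => exact h'.2.1
  refine ⟨{u | ReflTransGen (G.MoralAdj x y Z) x u}, .refl, fun hy => ?_, hL, ?_⟩
  · have hr : G.ActiveReach Z x y := (activeReach_of_moral hy).elim id id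
    rcases hr with rfl | ⟨i, hi⟩
    · exact hxy rfl
    · obtain ⟨n, p, hp, h0, -, hn⟩ := hi.exists_seq
      exact h.not_isActiveSeq _ p h0 hn hp
  · intro c hc u v hu hv huL hvZ
    exact .tail huL ⟨hL u huL, hvZ, c, hc, hu, hv⟩

section Finite

variable [Fintype V]

theorem mem_parents {u v : V} : u ∈ G.parents v ↔ G.arc u v := by simp [parents]

theorem mem_nonDescendants {u v : V} :
    u ∈ G.nonDescendants v ↔ u ≠ v ∧ ¬ G.IsDescendant v u := by simp [nonDescendants]

theorem exists_mem_forall_not_isDescendant (G : CausalDAG V) {S : Finset V} (hS : S.Nonempty) :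
    ∃ v ∈ S, ∀ u ∈ S, ¬ G.IsDescendant v u := by
  let r : V → V → Prop := fun u v => Relation.TransGen G.arc v u
  have : IsTrans V r := ⟨fun _ _ _ h₁ h₂ => Relation.TransGen.trans h₂ h₁⟩
  have : Std.Irrefl r := ⟨G.acyclic⟩
  obtain ⟨v, hv, h⟩ := (Finite.wellFounded_of_trans_of_irrefl r).has_min (S : Set V) hS
  exact ⟨v, hv, h⟩

end Finite

/-! ### The parents of the decision form a block set. -/

theorem isBlockSet_parents [Fintype V] [DecidableEq V] {C E : V} (hCE : G.arc C E) :
    G.IsBlockSet C E (G.parents E \ {C}) := by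
  have hmem : ∀ v, v ∈ G.parents E \ {C} ↔ G.arc v E ∧ v ≠ C := by simp [parents]
  have hdesc : ∀ d, G.IsDescendant E d → d ∉ G.parents E \ {C} := fun d hd hdQ =>
    G.acyclic E (.tail hd ((hmem d).1 hdQ).1)
  have hsub : ∀ u v, TransGen (G.deleteArc C E).arc u v → TransGen G.arc u v := fun u v h =>
    TransGen.mono (fun _ _ h' => h'.1) _ _ h
  refine ⟨by simp, fun h => G.acyclic E (.single ((hmem E).1 h).1), fun w _ => ?_, hdesc⟩
  by_contra hb
  have hstep : ∀ k, k < w.length →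
      (G.deleteArc C E).arc (w.getVert k) (w.getVert (k + 1)) ∨
      (G.deleteArc C E).arc (w.getVert (k + 1)) (w.getVert k) := fun k hk =>
    skeleton_adj.1 (w.adj_getVert_succ hk)
  -- Read an unblocked path backwards from `E`. Its last arc cannot enter `E`, since the parent
  -- before `E` would be a blocking non-collider in Q. So it leaves `E`, and the arcs keep pointing
  -- towards `C`: a turn would be a collider at a descendant of `E`, which is closed. Hence `C`
  -- would descend from `E`.
  have key : ∀ j, j < w.length → (G.deleteArc C E).arc (w.getVert (w.length - j))
        (w.getVert (w.length - j - 1)) ∧ G.IsDescendant E (w.getVert (w.length - j - 1)) := by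
    intro j
    induction j with
    | zero =>
      intro hlen
      obtain ⟨n, hn⟩ : ∃ n, w.length = n + 1 := ⟨w.length - 1, by omega⟩
      have hE : w.getVert (n + 1) = E := by rw [← hn, w.getVert_length]
      simp only [hn, Nat.sub_zero, Nat.add_sub_cancel]
      rcases hstep n (by omega) with h | h
      · exfalso
        have hnE := h.1
        rw [hE] at hnE
        have hC : w.getVert n ≠ C := fun h' => h.2 ⟨h', hE⟩
        obtain ⟨m, rfl⟩ : ∃ m, n = m + 1 := by
          refine Nat.exists_eq_succ_of_ne_zero ?_
          rintro rfl
          exact hC w.getVert_zero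
        refine hb ⟨m, by omega, .inl ⟨?_, (hmem _).2 ⟨hnE, hC⟩⟩⟩
        rcases hstep m (by omega) with h' | h'
        exacts [.inl ⟨h', h⟩, .inr (.inr ⟨h', h⟩)]
      · have hEn := h.1
        rw [hE] at hEn
        exact ⟨h, .single hEn⟩
    | succ j ih =>
      intro hj
      obtain ⟨n, hn⟩ : ∃ n, w.length = n + 2 + j := ⟨w.length - j - 2, by omega⟩
      have ih := ih (by omega)
      rw [show w.length - j = n + 2 by omega, show n + 2 - 1 = n + 1 by omega] at ih
      rw [show w.length - (j + 1) = n + 1 by omega, show n + 1 - 1 = n by omega]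
      rcases hstep n (by omega) with h | h
      · exfalso
        exact hb ⟨n, by omega, .inr ⟨⟨h, ih.1⟩, hdesc _ ih.2,
          fun d hd => hdesc d (ih.2.trans (hsub _ _ hd))⟩⟩
      · exact ⟨h, .tail ih.2 h.1⟩
  have hpos : 0 < w.length := by
    rcases Nat.eq_zero_or_pos w.length with h | h
    · have : C = E := SimpleGraph.Walk.eq_of_length_eq_zero h
      subst this
      exact absurd (.single hCE) (G.acyclic C)
    · exact h
  have h := (key (w.length - 1) (by omega)).2
  rw [show w.length - (w.length - 1) - 1 = 0 by omega, w.getVert_zero] at h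
  exact G.acyclic E (.tail h hCE)

end Graph

/-! ### Factorization and conditional independence. -/

section Probability

open Finset

theorem prob_nonneg {Ω : Type*} [Fintype Ω] (P : PMF Ω) (A : Set Ω) : 0 ≤ prob P A :=
  Finset.sum_nonneg fun _ _ => Set.indicator_nonneg (fun _ _ => ENNReal.toReal_nonneg) _

theorem prob_mono {Ω : Type*} [Fintype Ω] (P : PMF Ω) {A B : Set Ω} (h : A ⊆ B) :
    prob P A ≤ prob P B :=
  Finset.sum_le_sum fun x _ =>
    Set.indicator_le_indicator_of_subset h (fun _ => ENNReal.toReal_nonneg) x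

theorem prob_eq_zero_of_subset {Ω : Type*} [Fintype Ω] (P : PMF Ω) {A B : Set Ω} (h : A ⊆ B)
    (hB : prob P B = 0) : prob P A = 0 :=
  le_antisymm (hB ▸ prob_mono P h) (prob_nonneg P A)

@[simp]
theorem prob_empty {Ω : Type*} [Fintype Ω] (P : PMF Ω) : prob P ∅ = 0 := by simp [prob]

@[simp]
theorem prob_univ {Ω : Type*} [Fintype Ω] (P : PMF Ω) : prob P Set.univ = 1 := by
  have h := P.tsum_coe
  rw [tsum_fintype] at h
  simp only [prob, Set.indicator_univ]
  rw [← ENNReal.toReal_sum fun x _ => P.apply_ne_top x, h, ENNReal.toReal_one]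

variable {V : Type*} {α : V → Type*}

/-- Membership in `A` depends only on the values of the attributes in `S`. -/
def Determined (A : Set (∀ v, α v)) (S : Set V) : Prop :=
  ∀ y z, (∀ v ∈ S, y v = z v) → y ∈ A → z ∈ A

theorem Determined.inter {A B : Set (∀ v, α v)} {S : Set V} (hA : Determined A S)
    (hB : Determined B S) : Determined (A ∩ B) S := fun y z h hy =>
  ⟨hA y z h hy.1, hB y z h hy.2⟩

theorem Determined.mono {A : Set (∀ v, α v)} {S T : Set V} (hA : Determined A S) (h : S ⊆ T) :
    Determined A T := fun y z hyz => hA y z fun v hv => hyz v (h hv)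

theorem determined_event {S : Finset V} (s : Assign α S) :
    Determined (event s) (S : Set V) := fun y z h hy v => by
  rw [← h v v.2]
  exact hy v

theorem determined_eventEq (v : V) (a : α v) : Determined (eventEq v a) {v} := fun _ _ h hy =>
  (h v rfl).symm.trans hy

/-- The assignments that agree with `x` on `S`. -/
abbrev agree (S : Finset V) (x : ∀ v, α v) : Set (∀ v, α v) :=
  event (S := S) fun v => x v

theorem mem_agree {S : Finset V} {x y : ∀ v, α v} : y ∈ agree S x ↔ ∀ v ∈ S, y v = x v :=
  ⟨fun h v hv => h ⟨v, hv⟩, fun h v => h v v.2⟩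

theorem agree_congr {S : Finset V} {x y : ∀ v, α v} (h : ∀ v ∈ S, x v = y v) :
    agree S x = agree S y := by
  ext z
  simp only [mem_agree]
  exact forall₂_congr fun v hv => by rw [h v hv]

open Classical in
/-- The assignment that agrees with `z` on `L` and with `y` elsewhere. -/
noncomputable def splice (L : Set V) (y z : ∀ v, α v) : ∀ v, α v :=
  fun v => if v ∈ L then z v else y v

theorem splice_of_mem {L : Set V} {v : V} (hv : v ∈ L) (y z : ∀ v, α v) :
    splice L y z v = z v := if_pos hv

theorem splice_of_notMem {L : Set V} {v : V} (hv : v ∉ L) (y z : ∀ v, α v) :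
    splice L y z v = y v := if_neg hv

theorem splice_splice (L : Set V) (y z : ∀ v, α v) :
    splice L (splice L y z) (splice L z y) = y := by
  funext v
  by_cases hv : v ∈ L
  · rw [splice_of_mem hv, splice_of_mem hv]
  · rw [splice_of_notMem hv, splice_of_notMem hv]

variable [Fintype V] [DecidableEq V] [∀ v, Fintype (α v)] {G : CausalDAG V} {P : PMF (∀ v, α v)}

theorem sum_prob_event_inter (P : PMF (∀ v, α v)) (S : Finset V) (A : Set (∀ v, α v)) :
    ∑ s : Assign α S, prob P (event s ∩ A) = prob P A := by
  simp only [prob]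
  rw [Finset.sum_comm]
  refine Finset.sum_congr rfl fun x _ => ?_
  rw [Finset.sum_eq_single (fun v : S => x v)]
  · by_cases hx : x ∈ A
    · rw [Set.indicator_of_mem hx, Set.indicator_of_mem
        (show x ∈ event (fun v : S => x v) ∩ A from ⟨fun _ => rfl, hx⟩)]
    · rw [Set.indicator_of_notMem hx, Set.indicator_of_notMem fun h => hx h.2]
  · intro s _ hs
    exact Set.indicator_of_notMem (fun h => hs (funext fun v => (h.1 v).symm)) _
  · simp

/-- The local Markov condition for events that are determined by the non-descendants. -/
theorem Markov.prob_inter_mul (hM : G.Markov P) (v : V) (x : ∀ v, α v) (A : Set (∀ v, α v))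
    (hA : Determined A (G.nonDescendants v : Set V)) (hAx : A ⊆ agree (G.parents v) x) :
    prob P (agree {v} x ∩ A) * prob P (agree (G.parents v) x) =
      prob P (agree {v} x ∩ agree (G.parents v) x) * prob P A := by
  rw [← sum_prob_event_inter P (G.nonDescendants v) A,
    ← sum_prob_event_inter P (G.nonDescendants v) (agree {v} x ∩ A), Finset.sum_mul,
    Finset.mul_sum]
  refine Finset.sum_congr rfl fun t _ => ?_
  rcases Set.eq_empty_or_nonempty (event t ∩ A) with h | ⟨y, hyt, hyA⟩
  · rw [h, Set.inter_left_comm, h]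
    simp
  -- `t` fixes all non-descendants, so its event lies inside `A` or misses it.
  have htA : event t ⊆ A := fun z hz =>
    hA y z (fun u hu => (hyt ⟨u, hu⟩).trans (hz ⟨u, hu⟩).symm) hyA
  rw [Set.inter_left_comm, Set.inter_eq_left.2 htA]
  rcases (prob_nonneg P (event t)).eq_or_lt with h0 | h0
  · rw [prob_eq_zero_of_subset P Set.inter_subset_right h0.symm, ← h0]
    simp
  have htx := htA.trans hAx
  have h := hM v (fun u => x u) t (fun u => x u) (by rwa [Set.inter_eq_left.2 htx])
  rw [Set.inter_eq_left.2 htx, condProb, condProb,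
    div_eq_div_iff h0.ne' (h0.trans_le (prob_mono P htx)).ne'] at h
  exact h

/-- The conditional probability of the value of `v` under `x` given the values of the parents
of `v` under `x`. -/
noncomputable def kernel (G : CausalDAG V) (P : PMF (∀ v, α v)) (v : V) (x : ∀ v, α v) : ℝ :=
  condProb P (agree {v} x) (agree (G.parents v) x)

theorem kernel_congr {v : V} {x y : ∀ v, α v} (h : ∀ u, (u = v ∨ G.arc u v) → x u = y u) :
    G.kernel P v x = G.kernel P v y := by
  rw [kernel, kernel, agree_congr (S := {v}) (x := x) (y := y),
    agree_congr (S := G.parents v) (x := x) (y := y)]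
  · exact fun u hu => h u (.inr (mem_parents.1 hu))
  · exact fun u hu => h u (.inl (Finset.mem_singleton.1 hu))

/-- The marginal distribution of an ancestral set factorizes along the graph. -/
theorem Markov.prob_agree (hM : G.Markov P) (S : Finset V)
    (hS : ∀ v ∈ S, ∀ u, G.arc u v → u ∈ S) (x : ∀ v, α v) :
    prob P (agree S x) = ∏ v ∈ S, G.kernel P v x := by
  induction S using Finset.strongInduction with
  | _ S ih =>
    rcases S.eq_empty_or_nonempty with rfl | hne
    · have : agree ∅ x = Set.univ := Set.eq_univ_of_forall fun y => mem_agree.2 (by simp)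
      simp [this]
    obtain ⟨v, hv, hmax⟩ := G.exists_mem_forall_not_isDescendant hne
    have ih := ih (S.erase v) (Finset.erase_ssubset hv) fun w hw u huw =>
      Finset.mem_erase.2 ⟨by
        rintro rfl
        exact hmax w (Finset.mem_of_mem_erase hw) (.single huw),
        hS w (Finset.mem_of_mem_erase hw) u huw⟩
    rw [← Finset.mul_prod_erase S _ hv, ← ih]
    have hsplit : agree S x = agree {v} x ∩ agree (S.erase v) x := by
      ext y
      simp only [Set.mem_inter_iff, mem_agree, Finset.mem_singleton, forall_eq]
      refine ⟨fun h => ⟨h v hv, fun u hu => h u (Finset.mem_of_mem_erase hu)⟩, fun h u hu => ?_⟩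
      rcases eq_or_ne u v with rfl | huv
      exacts [h.1, h.2 u (Finset.mem_erase.2 ⟨huv, hu⟩)]
    have hsub : agree (S.erase v) x ⊆ agree (G.parents v) x := fun y hy =>
      mem_agree.2 fun u hu => mem_agree.1 hy u (Finset.mem_erase.2 ⟨by
        rintro rfl
        exact G.acyclic u (.single (mem_parents.1 hu)), hS v hv u (mem_parents.1 hu)⟩)
    have h := hM.prob_inter_mul v x (agree (S.erase v) x)
      ((determined_event _).mono fun u hu => mem_nonDescendants.2
        ⟨Finset.ne_of_mem_erase hu, hmax u (Finset.mem_of_mem_erase hu)⟩) hsub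
    rw [← hsplit] at h
    rcases (prob_nonneg P (agree (G.parents v) x)).eq_or_lt with h0 | h0
    -- Here the kernel is 0 by the convention for division, and the left side vanishes as well.
    · rw [kernel, condProb, ← h0, div_zero, zero_mul]
      refine prob_eq_zero_of_subset P ?_ h0.symm
      rw [hsplit]
      exact Set.inter_subset_right.trans hsub
    · rw [kernel, condProb, div_mul_eq_mul_div, eq_div_iff h0.ne', h]

/-- Marginals on `S` are summed over full assignments, to avoid restricting them; each outcome is
then counted once per choice of values off `S`. -/
theorem sum_indicator_mul_prob_agree (P : PMF (∀ v, α v)) (S : Finset V) (D : Set (∀ v, α v))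
    (hD : Determined D (S : Set V)) :
    ∑ y, D.indicator 1 y * prob P (agree S y) =
      (∏ v, if v ∈ S then 1 else Fintype.card (α v) : ℕ) * prob P D := by
  classical
  simp only [prob, Finset.mul_sum]
  rw [Finset.sum_comm]
  refine Finset.sum_congr rfl fun z _ => ?_
  have hcard : (∏ v, if v ∈ S then 1 else Fintype.card (α v) : ℕ) =
      #{y : ∀ v, α v | z ∈ agree S y} := by
    have : ({y : ∀ v, α v | z ∈ agree S y} : Finset _) =
        Fintype.piFinset fun v => if v ∈ S then {z v} else Finset.univ := by
      ext y
      simp only [Finset.mem_filter_univ, mem_agree, Fintype.mem_piFinset]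
      refine forall_congr' fun v => ?_
      by_cases hv : v ∈ S <;> simp [hv, eq_comm]
    rw [this, Fintype.card_piFinset]
    refine Finset.prod_congr rfl fun v _ => ?_
    split_ifs <;> simp
  rw [hcard, ← nsmul_eq_mul, ← Finset.sum_const, Finset.sum_filter]
  refine Finset.sum_congr rfl fun y _ => ?_
  by_cases hz : z ∈ agree S y
  · rw [if_pos hz, Set.indicator_of_mem hz]
    have hzy := mem_agree.1 hz
    by_cases hzD : z ∈ D
    · rw [Set.indicator_of_mem hzD, Set.indicator_of_mem (hD z y hzy hzD), Pi.one_apply, one_mul]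
    · rw [Set.indicator_of_notMem hzD, Set.indicator_of_notMem
        fun h => hzD (hD y z (fun v hv => (hzy v hv).symm) h), zero_mul]
  · rw [if_neg hz, Set.indicator_of_notMem hz, mul_zero]

/-- If no family of nodes in the ancestral set `S` meets both `L` and the complement of `L ∪ B`,
then events determined by `L` are independent, given the values on `B`, of events determined by
the complement of `L`. -/
theorem Markov.prob_mul_prob_of_separating (hM : G.Markov P) {S B : Finset V} {L : Set V}
    (hS : ∀ v ∈ S, ∀ u, G.arc u v → u ∈ S) (hBS : B ⊆ S) (hL : ∀ u ∈ L, u ∉ B)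
    (hsep : ∀ c ∈ S, ∀ u v, (u = c ∨ G.arc u c) → (v = c ∨ G.arc v c) → u ∈ L → v ∉ B → v ∈ L)
    {D₁ D₂ : Set (∀ v, α v)} (h₁ : Determined D₁ (L ∩ S)) (h₂ : Determined D₂ (Lᶜ ∩ S))
    (b : Assign α B) :
    prob P (D₁ ∩ (D₂ ∩ event b)) * prob P (event b) =
      prob P (D₁ ∩ event b) * prob P (D₂ ∩ event b) := by
  have hb : Determined (event b) (Lᶜ ∩ (S : Set V)) := (determined_event b).mono fun v hv =>
    ⟨fun hvL => hL v hvL hv, hBS hv⟩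
  have hbS := hb.mono Set.inter_subset_right
  have h₁S := h₁.mono Set.inter_subset_right
  have h₂S := h₂.mono Set.inter_subset_right
  have hW : ∀ y ∈ event b, ∀ z ∈ event b, prob P (agree S y) * prob P (agree S z) =
      prob P (agree S (splice L y z)) * prob P (agree S (splice L z y)) := by
    intro y hy z hz
    have hyz : ∀ v ∈ B, y v = z v := fun v hv => (hy ⟨v, hv⟩).trans (hz ⟨v, hv⟩).symm
    simp only [hM.prob_agree S hS, ← Finset.prod_mul_distrib]
    refine Finset.prod_congr rfl fun c hc => ?_
    -- A family meeting `L` lies in `L ∪ B`, where the splices agree with `y` and `z` in swapped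
    -- order; any other family misses `L` and is unaffected.
    by_cases hcL : ∃ u, (u = c ∨ G.arc u c) ∧ u ∈ L
    · obtain ⟨u, hu, huL⟩ := hcL
      rw [mul_comm]
      congr 1 <;> refine kernel_congr fun v hv => ?_ <;> by_cases hvL : v ∈ L
      · rw [splice_of_mem hvL]
      · rw [splice_of_notMem hvL, hyz v (by_contra fun hvB => hvL (hsep c hc u v hu hv huL hvB))]
      · rw [splice_of_mem hvL]
      · rw [splice_of_notMem hvL, hyz v (by_contra fun hvB => hvL (hsep c hc u v hu hv huL hvB))]
    · congr 1 <;> refine kernel_congr fun v hv => (splice_of_notMem (fun hvL => ?_) _ _).symm <;>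
        exact hcL ⟨v, hv, hvL⟩
  have hon : ∀ y z : ∀ v, α v, ∀ v ∈ L ∩ (S : Set V), splice L z y v = y v :=
    fun y z v hv => splice_of_mem hv.1 _ _
  have hoff : ∀ y z : ∀ v, α v, ∀ v ∈ Lᶜ ∩ (S : Set V), splice L y z v = y v :=
    fun y z v hv => splice_of_notMem hv.1 _ _
  have hmem : ∀ y z : ∀ v, α v, (y ∈ D₁ ∩ (D₂ ∩ event b) ∧ z ∈ event b) ↔
      (splice L z y ∈ D₁ ∩ event b ∧ splice L y z ∈ D₂ ∩ event b) := by
    intro y z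
    have on := hon y z
    have off := hoff y z
    have off' := hoff z y
    exact ⟨fun ⟨⟨hy₁, hy₂, hyb⟩, hzb⟩ =>
        ⟨⟨h₁ _ _ (fun v hv => (on v hv).symm) hy₁, hb _ _ (fun v hv => (off' v hv).symm) hzb⟩,
          h₂ _ _ (fun v hv => (off v hv).symm) hy₂, hb _ _ (fun v hv => (off v hv).symm) hyb⟩,
      fun ⟨⟨hy₁, hzb⟩, hy₂, hyb⟩ =>
        ⟨⟨h₁ _ _ on hy₁, h₂ _ _ off hy₂, hb _ _ off hyb⟩, hb _ _ off' hzb⟩⟩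
  have hN : ((∏ v, if v ∈ S then 1 else Fintype.card (α v) : ℕ) : ℝ) ≠ 0 := by
    obtain ⟨x, -⟩ := P.support_nonempty
    rw [Nat.cast_ne_zero, Finset.prod_ne_zero_iff]
    intro v _
    have : Nonempty (α v) := ⟨x v⟩
    split_ifs
    exacts [one_ne_zero, Fintype.card_ne_zero]
  refine mul_left_cancel₀ (mul_ne_zero hN hN) ?_
  rw [mul_mul_mul_comm _ _ (prob P (D₁ ∩ (D₂ ∩ event b))),
    mul_mul_mul_comm _ _ (prob P (D₁ ∩ event b)),
    ← sum_indicator_mul_prob_agree P S _ (h₁S.inter (h₂S.inter hbS)),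
    ← sum_indicator_mul_prob_agree P S _ hbS,
    ← sum_indicator_mul_prob_agree P S _ (h₁S.inter hbS),
    ← sum_indicator_mul_prob_agree P S _ (h₂S.inter hbS),
    Finset.sum_mul_sum, Finset.sum_mul_sum, ← Fintype.sum_prod_type', ← Fintype.sum_prod_type']
  -- Exchanging the `L`-coordinates is a bijection on pairs that matches the two double sums term by
  -- term.
  have hinv : Function.Involutive
      fun p : (∀ v, α v) × (∀ v, α v) => (splice L p.2 p.1, splice L p.1 p.2) := fun p =>
    Prod.ext (splice_splice L p.1 p.2) (splice_splice L p.2 p.1)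
  refine Fintype.sum_equiv hinv.toPerm _ _ ?_
  rintro ⟨y, z⟩
  change (D₁ ∩ (D₂ ∩ event b)).indicator 1 y * prob P (agree S y) *
      ((event b).indicator 1 z * prob P (agree S z)) =
    (D₁ ∩ event b).indicator 1 (splice L z y) * prob P (agree S (splice L z y)) *
      ((D₂ ∩ event b).indicator 1 (splice L y z) * prob P (agree S (splice L y z)))
  by_cases h : y ∈ D₁ ∩ (D₂ ∩ event b) ∧ z ∈ event b
  · have h' := (hmem y z).1 h
    rw [Set.indicator_of_mem h.1, Set.indicator_of_mem h.2, Set.indicator_of_mem h'.1,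
      Set.indicator_of_mem h'.2]
    simp only [Pi.one_apply, one_mul]
    rw [hW y h.1.2.2 z h.2, mul_comm]
  · have h' := mt (hmem y z).2 h
    rw [mul_mul_mul_comm, mul_mul_mul_comm (Set.indicator _ _ (splice L z y))]
    rcases not_and_or.1 h with h | h <;> rcases not_and_or.1 h' with h' | h' <;>
      rw [Set.indicator_of_notMem h, Set.indicator_of_notMem h'] <;> simp only [zero_mul, mul_zero]

end Probability

/-! ### The two independences for a block set. -/

section BlockSet

open Relation

variable {V : Type*} [DecidableEq V] {α : V → Type*} {B Q : Finset V}

theorem event_inter_event_subset_glue (b : Assign α B) (q' : Assign α (Q \ B)) :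
    event q' ∩ event b ⊆ event (glue b q') := by
  rintro x ⟨hq, hb⟩ v
  simp only [glue]
  split_ifs with h
  exacts [hb ⟨v, h⟩, hq ⟨v, _⟩]

variable [Fintype V] [∀ v, Fintype (α v)] {G : CausalDAG V} {P : PMF (∀ v, α v)} {C E : V}

/-- Given a block set, the protected attribute is independent of the remaining parents of the
decision. -/
theorem IsBlockSet.prob_mul_prob (hB : G.IsBlockSet C E B) (hM : G.Markov P) (hCE : G.arc C E)
    (hQ : Q = G.parents E \ {C}) (c : α C) (q' : Assign α (Q \ B)) (b : Assign α B) :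
    prob P (eventEq C c ∩ (event q' ∩ event b)) * prob P (event b) =
      prob P (eventEq C c ∩ event b) * prob P (event q' ∩ event b) := by
  classical
  obtain ⟨hCB, hEB, hsep, hdesc⟩ := hB
  have hne : C ≠ E := by
    rintro rfl
    exact G.acyclic C (.single hCE)
  obtain ⟨L, hCL, hEL, hLB, hfam⟩ := hsep.exists_separating hne hCB
  have harc : ∀ u c, G.arc u c → c ≠ E → (G.deleteArc C E).arc u c := fun u c h hc =>
    ⟨h, fun h' => hc h'.2⟩
  have hQE : ∀ u ∈ Q, (G.deleteArc C E).arc u E := by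
    intro u hu
    simp only [hQ, Finset.mem_sdiff, mem_parents, Finset.mem_singleton] at hu
    exact ⟨hu.1, fun h => hu.2 h.1⟩
  have hsub : ∀ u v, ReflTransGen (G.deleteArc C E).arc u v → ReflTransGen G.arc u v :=
    fun u v h => ReflTransGen.mono (fun _ _ h' => h'.1) _ _ h
  -- Without `E`, this set is ancestral in `G`: `E` is not an ancestor of `C` by acyclicity, nor of
  -- `B` by the block-set condition.
  let S : Finset V := {c | c ≠ E ∧ (G.deleteArc C E).IsRelevant C E B c}
  have hmem : ∀ c, c ∈ S ↔ c ≠ E ∧ (G.deleteArc C E).IsRelevant C E B c := fun c => by simp [S]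
  have hBS : B ⊆ S := fun v hv => (hmem v).2
    ⟨fun h => hEB (h ▸ hv), .inr (.inr ⟨v, hv, .refl⟩)⟩
  refine hM.prob_mul_prob_of_separating (S := S) (L := L) ?_ hBS hLB ?_
    ((determined_eventEq C c).mono ?_) ((determined_event q').mono ?_) b
  · intro v hv u huv
    obtain ⟨hvE, hv⟩ := (hmem v).1 hv
    refine (hmem u).2 ⟨?_, ?_⟩
    · rintro rfl
      rcases hv with h | h | ⟨d, hd, h⟩
      · exact G.acyclic C (.trans_left (.head hCE (.single huv)) (hsub _ _ h))
      · exact G.acyclic u (.trans_left (.single huv) (hsub _ _ h))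
      · exact hdesc d (.trans_left (.single huv) (hsub _ _ h)) hd
    · have huv' := harc u v huv hvE
      rcases hv with h | h | ⟨d, hd, h⟩
      exacts [.inl (.head huv' h), .inr (.inl (.head huv' h)), .inr (.inr ⟨d, hd, .head huv' h⟩)]
  · intro c hc u v hu hv
    obtain ⟨hcE, hc⟩ := (hmem c).1 hc
    exact hfam c hc u v (hu.imp_right fun h => harc u c h hcE)
      (hv.imp_right fun h => harc v c h hcE)
  · rw [Set.singleton_subset_iff]
    exact ⟨hCL, (hmem C).2 ⟨hne, .inl .refl⟩⟩
  · intro v hv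
    obtain ⟨hvQ, hvB⟩ := Finset.mem_sdiff.1 (Finset.mem_coe.1 hv)
    have hvE := hQE v hvQ
    -- The family of `E` in G' contains Q, so a member of Q \ B in `L` would pull `E` into `L`.
    refine ⟨fun hvL => hEL (hfam E (.inr (.inl .refl)) v E (.inr hvE) (.inl rfl) hvL hEB),
      (hmem v).2 ⟨?_, .inr (.inl (.single hvE))⟩⟩
    rintro rfl
    exact (G.deleteArc C v).acyclic v (.single hvE)

/-- Given the values on all its parents, the decision is independent of the block set. -/
theorem IsBlockSet.prob_mul_prob_glue (hB : G.IsBlockSet C E B) (hM : G.Markov P)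
    (hCE : G.arc C E) (hQ : Q = G.parents E \ {C}) (c : α C) (e : α E) (q' : Assign α (Q \ B))
    (b : Assign α B) :
    prob P (eventEq E e ∩ (eventEq C c ∩ (event q' ∩ event b))) *
        prob P (eventEq C c ∩ event (glue b q')) =
      prob P (eventEq E e ∩ (eventEq C c ∩ event (glue b q'))) *
        prob P (eventEq C c ∩ (event q' ∩ event b)) := by
  rcases Set.eq_empty_or_nonempty (eventEq E e ∩ (eventEq C c ∩ event (glue b q')))
    with h | ⟨x, hxE, hxC, hxq⟩
  · rw [h, prob_empty, zero_mul, prob_eq_zero_of_subset P _ (h ▸ prob_empty P), zero_mul]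
    exact Set.inter_subset_inter_right _
      (Set.inter_subset_inter_right _ (event_inter_event_subset_glue b q'))
  have hparents : ∀ u, G.arc u E ↔ u = C ∨ u ∈ Q := by
    intro u
    simp only [hQ, Finset.mem_sdiff, mem_parents, Finset.mem_singleton]
    refine ⟨fun h => ?_, ?_⟩
    · by_cases huC : u = C
      exacts [.inl huC, .inr ⟨h, huC⟩]
    · rintro (rfl | h)
      exacts [hCE, h.1]
  have hE : agree {E} x = eventEq E e := by
    ext y
    simp only [mem_agree, Finset.mem_singleton, forall_eq]
    exact ⟨fun h => h.trans hxE, fun h => Eq.trans h (Eq.symm hxE)⟩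
  have hpa : agree (G.parents E) x = eventEq C c ∩ event (glue b q') := by
    ext y
    simp only [mem_agree, mem_parents, hparents]
    refine ⟨fun h => ⟨(h C (.inl rfl)).trans hxC, fun v => (h v (.inr v.2)).trans (hxq v)⟩, ?_⟩
    rintro ⟨hyC, hyq⟩ u (rfl | hu)
    exacts [Eq.trans hyC (Eq.symm hxC), (hyq ⟨u, hu⟩).trans (hxq ⟨u, hu⟩).symm]
  have hnd : ∀ u, G.arc u E → u ∈ G.nonDescendants E := fun u hu => mem_nonDescendants.2 ⟨by
    rintro rfl
    exact G.acyclic u (.single hu), fun h => G.acyclic E (.tail h hu)⟩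
  rw [← hE, ← hpa]
  refine hM.prob_inter_mul E x _ ?_ ?_
  · refine ((determined_eventEq C c).mono ?_).inter
      (((determined_event q').mono ?_).inter ((determined_event b).mono ?_))
    · rintro _ rfl
      exact hnd _ hCE
    · exact fun u hu => hnd u ((hparents u).2 (.inr (Finset.mem_sdiff.1 hu).1))
    · exact fun u hu => mem_nonDescendants.2
        ⟨fun h => hB.2.1 (h ▸ hu), fun h => hB.2.2.2 u h hu⟩
  · rw [hpa]
    exact Set.inter_subset_inter_right _ (event_inter_event_subset_glue b q')

theorem sum_condProb_event (P : PMF (∀ v, α v)) (S : Finset V) {A : Set (∀ v, α v)}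
    (hA : 0 < prob P A) : ∑ s : Assign α S, condProb P (event s) A = 1 := by
  simp only [condProb]
  rw [← Finset.sum_div, sum_prob_event_inter, div_self hA.ne']

theorem IsBlockSet.prob_glue_pos (hB : G.IsBlockSet C E B) (hM : G.Markov P) (hCE : G.arc C E)
    (hQ : Q = G.parents E \ {C}) {c : α C} {q' : Assign α (Q \ B)} {b : Assign α B}
    (hb : 0 < prob P (eventEq C c ∩ event b)) (hq : 0 < condProb P (event q') (event b)) :
    0 < prob P (eventEq C c ∩ event (glue b q')) := by
  have hb' := hb.trans_le (prob_mono P Set.inter_subset_right)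
  have hq' : 0 < prob P (event q' ∩ event b) := (div_pos_iff_of_pos_right hb').1 hq
  have h := hB.prob_mul_prob hM hCE hQ c q' b
  have hpos := pos_of_mul_pos_left (h ▸ mul_pos hb hq') hb'.le
  exact hpos.trans_le (prob_mono P
    (Set.inter_subset_inter_right _ (event_inter_event_subset_glue b q')))

theorem IsBlockSet.condProb_eq_sum (hB : G.IsBlockSet C E B) (hM : G.Markov P)
    (hCE : G.arc C E) (hQ : Q = G.parents E \ {C}) {c : α C} (e : α E) {b : Assign α B}
    (hb : 0 < prob P (eventEq C c ∩ event b)) :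
    condProb P (eventEq E e) (eventEq C c ∩ event b) =
      ∑ q' : Assign α (Q \ B), condProb P (event q') (event b) *
        condProb P (eventEq E e) (eventEq C c ∩ event (glue b q')) := by
  have hb' := hb.trans_le (prob_mono P Set.inter_subset_right)
  rw [condProb, div_eq_iff hb.ne', ← sum_prob_event_inter P (Q \ B), Finset.sum_mul]
  refine Finset.sum_congr rfl fun q' _ => ?_
  rw [Set.inter_left_comm, Set.inter_left_comm (event q')]
  have h := hB.prob_mul_prob hM hCE hQ c q' b
  rcases (prob_nonneg P (event q' ∩ event b)).eq_or_lt with h0 | h0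
  -- A zero weight hides the possibly meaningless conditional probability given `glue b q'`.
  · rw [condProb, ← h0, zero_div, zero_mul, zero_mul]
    exact prob_eq_zero_of_subset P (Set.inter_subset_right.trans Set.inter_subset_right) h0.symm
  · have hg := hB.prob_glue_pos hM hCE hQ hb (q' := q') (div_pos h0 hb')
    have hloc := hB.prob_mul_prob_glue hM hCE hQ c e q' b
    rw [eq_comm, condProb, condProb, div_mul_div_comm, div_mul_eq_mul_div,
      div_eq_iff (mul_pos hb' hg).ne']
    linear_combination (-prob P (eventEq E e ∩ (eventEq C c ∩ event (glue b q')))) * h -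
      prob P (event b) * hloc

end BlockSet

end CausalDAG

/-! ### Averaging the risk differences. -/

theorem mainTheorem1 {V : Type*} [Fintype V] [DecidableEq V] {α : V → Type*}
    [∀ v, Fintype (α v)] (G : CausalDAG V) (P : PMF (∀ v, α v)) (hMarkov : G.Markov P)
    (C E : V) (hCE : G.arc C E)
    (cpos cneg : α C) (hc : cpos ≠ cneg) (hC : ∀ c : α C, c = cpos ∨ c = cneg)
    (epos eneg : α E) (he : epos ≠ eneg) (hE : ∀ e : α E, e = epos ∨ e = eneg)
    (τ : ℝ) (hτ : 0 < τ)
    (Q : Finset V) (hQ : Q = G.parents E \ {C}) :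
    (G.NonDiscrimination P cpos cneg epos τ ↔
      ∀ q : CausalDAG.Assign α Q, CausalDAG.RiskDiffDefined P cpos cneg q →
        |CausalDAG.riskDiff P cpos cneg epos q| < τ) ∧
    G.IsBlockSet C E Q ∧
    (∀ B : Finset V, G.IsBlockSet C E B →
      ∀ b : CausalDAG.Assign α B, CausalDAG.RiskDiffDefined P cpos cneg b →
        (∀ q' : CausalDAG.Assign α (Q \ B),
          0 < CausalDAG.condProb P (CausalDAG.event q') (CausalDAG.event b) →
            CausalDAG.RiskDiffDefined P cpos cneg (CausalDAG.glue b q')) ∧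
        ∑ q' : CausalDAG.Assign α (Q \ B),
          CausalDAG.condProb P (CausalDAG.event q') (CausalDAG.event b) = 1 ∧
        CausalDAG.riskDiff P cpos cneg epos b =
          ∑ q' : CausalDAG.Assign α (Q \ B),
            CausalDAG.condProb P (CausalDAG.event q') (CausalDAG.event b) *
              CausalDAG.riskDiff P cpos cneg epos (CausalDAG.glue b q')) := by
  have hQB : G.IsBlockSet C E Q := hQ ▸ CausalDAG.isBlockSet_parents hCE
  have hpos : ∀ {B : Finset V} {c : α C} {b : CausalDAG.Assign α B},
      0 < CausalDAG.prob P (CausalDAG.eventEq C c ∩ CausalDAG.event b) →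
        0 < CausalDAG.prob P (CausalDAG.event b) := fun h =>
    h.trans_le (CausalDAG.prob_mono P Set.inter_subset_right)
  have main : ∀ B : Finset V, G.IsBlockSet C E B →
      ∀ b : CausalDAG.Assign α B, CausalDAG.RiskDiffDefined P cpos cneg b →
        (∀ q' : CausalDAG.Assign α (Q \ B),
          0 < CausalDAG.condProb P (CausalDAG.event q') (CausalDAG.event b) →
            CausalDAG.RiskDiffDefined P cpos cneg (CausalDAG.glue b q')) ∧
        ∑ q' : CausalDAG.Assign α (Q \ B),
          CausalDAG.condProb P (CausalDAG.event q') (CausalDAG.event b) = 1 ∧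
        CausalDAG.riskDiff P cpos cneg epos b =
          ∑ q' : CausalDAG.Assign α (Q \ B),
            CausalDAG.condProb P (CausalDAG.event q') (CausalDAG.event b) *
              CausalDAG.riskDiff P cpos cneg epos (CausalDAG.glue b q') := by
    intro B hB b hb
    refine ⟨fun q' hq' => ⟨hB.prob_glue_pos hMarkov hCE hQ hb.1 hq',
      hB.prob_glue_pos hMarkov hCE hQ hb.2 hq'⟩,
      CausalDAG.sum_condProb_event P _ (hpos hb.1), ?_⟩
    simp only [CausalDAG.riskDiff, mul_sub, Finset.sum_sub_distrib]
    rw [hB.condProb_eq_sum hMarkov hCE hQ epos hb.1, hB.condProb_eq_sum hMarkov hCE hQ epos hb.2]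
  refine ⟨⟨fun h q hq => h Q hQB q hq, fun h B hB b hb => ?_⟩, hQB, main⟩
  obtain ⟨hdef, hsum, hdiff⟩ := main B hB b hb
  have hw : ∀ q' : CausalDAG.Assign α (Q \ B),
      0 ≤ CausalDAG.condProb P (CausalDAG.event q') (CausalDAG.event b) := fun q' =>
    div_nonneg (CausalDAG.prob_nonneg P _) (CausalDAG.prob_nonneg P _)
  rw [hdiff, ← one_mul τ, ← hsum, Finset.sum_mul]
  refine (Finset.abs_sum_le_sum_abs _ _).trans_lt (Finset.sum_lt_sum (fun q' _ => ?_) ?_)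
  · rw [abs_mul, abs_of_nonneg (hw q')]
    rcases (hw q').eq_or_lt with h0 | h0
    · rw [← h0, zero_mul, zero_mul]
    · exact mul_le_mul_of_nonneg_left (h _ (hdef q' h0)).le h0.le
  -- The weights sum to 1, so one of them is positive; its term makes the bound strict.
  · obtain ⟨q', -, hq'⟩ := Finset.exists_lt_of_sum_lt (s := Finset.univ) (f := fun _ => (0 : ℝ))
      (g := fun q' : CausalDAG.Assign α (Q \ B) =>
        CausalDAG.condProb P (CausalDAG.event q') (CausalDAG.event b)) (by simp [hsum])
    refine ⟨q', Finset.mem_univ _, ?_⟩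
    rw [abs_mul, abs_of_nonneg (hw q')]
    exact mul_lt_mul_of_pos_left (h _ (hdef q' hq')) hq'
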